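/- Let $\mathbb U=\{z\in\mathbb C:|z|<1\}$ and let $\mathcal H$ be the class of complex-valued harmonic functions $f=h+\overline g$ in $\mathbb U$, with $h,g$ analytic in $\mathbb U$, normalized by $f(0)=h(0)=0$ and $h'(0)=1$; write $h(z)=z+\sum_{n\ge 2}a_nz^n$ and $a_1=1$. A domain $D\subset\mathbb C$ is called close-to-convex if $\mathbb C\setminus D$ is a union of half-lines which are pairwise non-intersecting, except that the origin of one half-line may lie on another one. Let $\mathcal C_{\mathcal H}$ be the class of all $f\in\mathcal H$ that are univalent and sense-preserving (i.e. with positive Jacobian $|h'|^2-|g'|^2$) in $\mathbb U$ and map $\mathbb U$ onto a close-to-convex domain. If $f\in\mathcal H$ is locally univalent and sense-preserving in $\mathbb U$ and $$\sum_{n=2}^{\infty}\Bigl\{n\bigl|(n+1)a_n-(n-1)a_{n-1}\bigr|+(n-1)\bigl|na_n-(n-2)a_{n-1}\bigr|\Bigr\}\le 2,$$ then $f\in\mathcal C_{\mathcal H}$. -/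

import Mathlib

open Metric Set
open scoped ComplexConjugate

namespace HarmonicMapping

/-- The open unit disk. -/
def unitDisk : Set ℂ := ball (0 : ℂ) 1

/-- `f` is a harmonic function on the unit disk, written as `f = h + conj g` with analytic part `h`
and co-analytic part `g`, and normalized by `f 0 = h 0 = 0` and `h' 0 = 1`. -/
structure IsNormalizedHarmonic (f h g : ℂ → ℂ) : Prop where
  harmonic : InnerProductSpace.HarmonicOnNhd f unitDisk
  analytic_h : AnalyticOnNhd ℂ h unitDisk
  analytic_g : AnalyticOnNhd ℂ g unitDisk
  decomp : ∀ z ∈ unitDisk, f z = h z + conj (g z)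
  map_zero : f 0 = 0
  h_zero : h 0 = 0
  deriv_h_zero : deriv h 0 = 1

/-- The class of normalized harmonic functions on the unit disk. -/
def classH : Set (ℂ → ℂ) := {f | ∃ h g, IsNormalizedHarmonic f h g}

/-- The `n`-th Taylor coefficient at the origin. -/
noncomputable def coeff (h : ℂ → ℂ) (n : ℕ) : ℂ := iteratedDeriv n h 0 / (n.factorial : ℂ)

/-- Injective near each point of the unit disk. -/
def LocallyUnivalent (f : ℂ → ℂ) : Prop :=
  ∀ z ∈ unitDisk, ∃ V : Set ℂ, IsOpen V ∧ z ∈ V ∧ InjOn f (V ∩ unitDisk)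

/-- The real Jacobian determinant of `f` is positive on the unit disk (for `f = h + conj g` it
equals `|h'|² - |g'|²`). -/
def SensePreserving (f : ℂ → ℂ) : Prop := ∀ z ∈ unitDisk, 0 < (fderiv ℝ f z).det

/-- The class of univalent sense-preserving normalized harmonic functions. -/
def classSH : Set (ℂ → ℂ) := {f | f ∈ classH ∧ InjOn f unitDisk ∧ SensePreserving f}

/-- The closed half-line with origin `p` and direction `u` (used for `‖u‖ = 1`). -/
def halfLine (p u : ℂ) : Set ℂ := {w | ∃ t : ℝ, 0 ≤ t ∧ w = p + t * u}

/-- A domain whose complement is a union of half-lines (`l.1` the origin, `l.2` the unit direction)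
which do not intersect, except that the origin of one may lie on another. -/
def IsCloseToConvexDomain (D : Set ℂ) : Prop :=
  IsOpen D ∧ IsConnected D ∧
    ∃ L : Set (ℂ × ℂ), (∀ l ∈ L, ‖l.2‖ = 1) ∧
      Dᶜ = ⋃ l ∈ L, halfLine l.1 l.2 ∧
      ∀ l ∈ L, ∀ m ∈ L, l ≠ m → halfLine l.1 l.2 ∩ halfLine m.1 m.2 ⊆ {l.1, m.1}

/-- The functions of `classSH` that map the unit disk onto a close-to-convex domain. -/
def classCH : Set (ℂ → ℂ) := {f | f ∈ classSH ∧ IsCloseToConvexDomain (f '' unitDisk)}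

/-- `n |(n+1) aₙ - (n-1) aₙ₋₁| + (n-1) |n aₙ - (n-2) aₙ₋₁|`, used for `n ≥ 2`. -/
noncomputable def coeffTerm (a : ℕ → ℂ) (n : ℕ) : ℝ :=
  (n : ℝ) * ‖((n : ℂ) + 1) * a n - ((n : ℂ) - 1) * a (n - 1)‖
    + ((n : ℝ) - 1) * ‖(n : ℂ) * a n - ((n : ℂ) - 2) * a (n - 1)‖

end HarmonicMapping

/-! Put `A = (1 - z)(2h' + zh'')` and `B = (1 - z)zh''`. The coefficient sum adds the moduli of the
Taylor coefficients of `A - 2` and `B`, so `|A - 2| + |B| ≤ 2|z| < 2` (`norm_add_norm_le_two_mul`).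
Hence `2(1 - z)h' = A - B` and `1 + zh''/h' = (A + B)/(A - B)` have positive real part. The former
makes `h` univalent, being twice the derivative of `h` in the variable `-log (1 - z)`, which ranges
over a convex domain; the latter then makes the image `Ω` of `h` convex. Summability makes `Ω`
bounded.

On `Ω`, `f` reads `w ↦ w + C w` with `C = conj ∘ g ∘ h⁻¹`, and `|g'| < |h'|` makes `C` strictly
nonexpansive. So identity plus `C` is strictly monotone and `f` is univalent. Extend `C` to the
closure of `Ω`. For `v` outside the image, a variational inequality yields a boundary point `p` with
`v - p - C p` in the outward normal cone at `p`; thus the half-lines from `p + C p` along outward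
normals cover the complement. Monotonicity keeps them off the image and makes any two that meet
share their origin (`isCloseToConvexDomain_image_add`). -/

namespace HarmonicMapping

open Filter Topology

/-! ### Variational inequalities for identity plus a nonexpansive map -/

section Monotone

variable {E : Type*} [NormedAddCommGroup E] [InnerProductSpace ℝ E]

/-- Points satisfying the variational inequality of the projection onto a set depend on the
projected point in a nonexpansive way. -/
theorem norm_sub_le_of_inner_le_zero {u u' a b : E} (ha : inner ℝ (u - a) (b - a) ≤ 0)
    (hb : inner ℝ (u' - b) (a - b) ≤ 0) : ‖a - b‖ ≤ ‖u - u'‖ := by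
  have h1 : ‖a - b‖ * ‖a - b‖ ≤ ‖u - u'‖ * ‖a - b‖ := by
    have h2 := real_inner_le_norm (u - u') (a - b)
    have h3 : inner ℝ (u - u') (a - b)
        = ‖a - b‖ * ‖a - b‖ - inner ℝ (u - a) (b - a) - inner ℝ (u' - b) (a - b) := by
      rw [← real_inner_self_eq_norm_mul_norm, ← neg_sub a b, inner_neg_right, sub_neg_eq_add,
        ← inner_add_left, ← inner_sub_left]
      congr 1
      abel
    linarith
  rcases (norm_nonneg (a - b)).eq_or_lt with h0 | h0
  · rw [← h0]; positivity
  · exact le_of_mul_le_mul_right h1 h0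

/-- Projection onto `K` is nonexpansive, so `p ↦ P (v - C p)` is a contraction of `K`; its fixed
point is the solution. -/
theorem exists_variational_ineq_of_contraction {K : Set E} (hK : IsComplete K) (hconv : Convex ℝ K)
    (hne : K.Nonempty) {C : E → E} {r : NNReal} (hr : r < 1) (hC : LipschitzOnWith r C K) (v : E) :
    ∃ p ∈ K, ∀ w ∈ K, inner ℝ (v - C p - p) (w - p) ≤ 0 := by
  have hproj : ∀ u : E, ∃ p ∈ K, ∀ w ∈ K, inner ℝ (u - p) (w - p) ≤ 0 := fun u => by
    obtain ⟨p, hp, h⟩ := exists_norm_eq_iInf_of_complete_convex hne hK hconv u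
    exact ⟨p, hp, (norm_eq_iInf_iff_real_inner_le_zero hconv hp).1 h⟩
  choose P hPK hP using hproj
  obtain ⟨x, hx⟩ := hne
  have hmaps : MapsTo (fun p => P (v - C p)) K K := fun p _ => hPK _
  have hcontr : ContractingWith r (hmaps.restrict (fun p => P (v - C p)) K K) := by
    refine ⟨hr, LipschitzWith.of_dist_le_mul fun a b => ?_⟩
    have h1 := hC.dist_le_mul a a.2 b b.2
    rw [Subtype.dist_eq, Subtype.dist_eq]
    refine le_trans ?_ h1
    rw [dist_eq_norm, dist_eq_norm, norm_sub_rev (C a)]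
    have h2 := norm_sub_le_of_inner_le_zero (hP (v - C a) _ (hPK (v - C b)))
      (hP (v - C b) _ (hPK (v - C a)))
    simpa using h2
  obtain ⟨p, hp, hfix, -⟩ := ContractingWith.exists_fixedPoint' hK hmaps hcontr hx (edist_ne_top _ _)
  refine ⟨p, hp, fun w hw => ?_⟩
  have := hP (v - C p) w hw
  rwa [show P (v - C p) = p from hfix] at this

/-- Solvability of a variational inequality for a nonexpansive perturbation of the identity. -/
theorem exists_variational_ineq {K : Set E} (hK : IsCompact K) (hconv : Convex ℝ K)
    (hne : K.Nonempty) {C : E → E} (hC : LipschitzOnWith 1 C K) (v : E) :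
    ∃ p ∈ K, ∀ w ∈ K, inner ℝ (v - C p - p) (w - p) ≤ 0 := by
  -- Damping `C` by factors `r n < 1` tending to `1` reduces to contractions; compactness of `K`
  -- supplies a limit of the solutions.
  obtain ⟨r, -, hr1, hr⟩ := exists_seq_strictMono_tendsto' (show (0 : NNReal) < 1 by norm_num)
  have hcon : ∀ n, ∃ p ∈ K, ∀ w ∈ K, inner ℝ (v - (r n : ℝ) • C p - p) (w - p) ≤ 0 := fun n => by
    refine exists_variational_ineq_of_contraction hK.isComplete hconv hne
      (C := fun p => (r n : ℝ) • C p) (hr1 n).2 (LipschitzOnWith.of_dist_le_mul fun a ha b hb => ?_) v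
    rw [dist_smul₀, Real.norm_of_nonneg (r n).coe_nonneg]
    have := hC.dist_le_mul a ha b hb
    simp only [NNReal.coe_one, one_mul] at this
    gcongr
  choose p hpK hp using hcon
  obtain ⟨q, hq, φ, hφ, hlim⟩ := hK.tendsto_subseq hpK
  refine ⟨q, hq, fun w hw => ?_⟩
  have hCl : Tendsto (fun n => C (p (φ n))) atTop (𝓝 (C q)) :=
    (hC.continuousOn q hq).tendsto.comp
      (tendsto_nhdsWithin_iff.2 ⟨hlim, Eventually.of_forall fun n => hpK _⟩)
  have hrl : Tendsto (fun n => ((r (φ n) : NNReal) : ℝ)) atTop (𝓝 1) :=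
    (NNReal.tendsto_coe.2 hr).comp hφ.tendsto_atTop
  have h := ((tendsto_const_nhds (x := v)).sub (hrl.smul hCl)).sub hlim |>.inner (𝕜 := ℝ)
    ((tendsto_const_nhds (x := w)).sub hlim)
  rw [one_smul] at h
  exact le_of_tendsto h (Eventually.of_forall fun n => hp _ w hw)

/-- A Lipschitz map on a set extends to its closure with the same constant. -/
theorem exists_lipschitzOnWith_closure {F : Type*} [NormedAddCommGroup F] [CompleteSpace F]
    {s : Set F} {C : F → F} {k : NNReal}
    (hC : LipschitzOnWith k C s) :
    ∃ C' : F → F, LipschitzOnWith k C' (closure s) ∧ EqOn C' C s := by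
  have heq : EqOn (extendFrom s C) C s := fun x hx => extendFrom_extends hC.continuousOn x hx
  refine ⟨extendFrom s C, LipschitzOnWith.closure ?_ fun x hx y hy => ?_, heq⟩
  · refine continuousOn_extendFrom subset_rfl fun x hx => ?_
    have : (𝓝[s] x).NeBot := mem_closure_iff_nhdsWithin_neBot.1 hx
    exact CompleteSpace.complete ((cauchy_nhds.mono nhdsWithin_le_nhds).map_of_le
      hC.uniformContinuousOn inf_le_right)
  · rw [heq hx, heq hy]; exact hC hx hy

end Monotone

/-! ### Half-lines filling the complement of the image -/

section Rays

/-- The equality case of the monotonicity of a nonexpansive perturbation of the identity. -/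
theorem add_eq_add_of_inner_le_zero {E : Type*} [NormedAddCommGroup E] [InnerProductSpace ℝ E]
    {x y : E} (hxy : ‖y‖ ≤ ‖x‖) (h : inner ℝ (x + y) x ≤ 0) : x + y = 0 := by
  have h1 : ‖x + y‖ ^ 2 ≤ 0 := by
    have h2 : ‖x + y‖ ^ 2 = 2 * inner ℝ (x + y) x + (‖y‖ ^ 2 - ‖x‖ ^ 2) := by
      rw [norm_add_sq_real, inner_add_left, real_inner_self_eq_norm_sq, real_inner_comm]; ring
    have h3 : ‖y‖ ^ 2 ≤ ‖x‖ ^ 2 := by gcongr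
    linarith
  simpa using le_antisymm h1 (by positivity)

/-- With `x = a - b` and `y = C a - C b` this is strict monotonicity of identity plus `C`. -/
theorem inner_add_pos {E : Type*} [NormedAddCommGroup E] [InnerProductSpace ℝ E]
    {x y : E} (hxy : ‖y‖ < ‖x‖) : 0 < inner ℝ (x + y) x := by
  by_contra! h
  have := add_eq_add_of_inner_le_zero hxy.le h
  rw [add_eq_zero_iff_eq_neg.1 this, norm_neg] at hxy
  exact lt_irrefl _ hxy

theorem halfLine_inter_subset_origin {p u q v : ℂ} (hpq : p = q) (hu : ‖u‖ = 1) (hv : ‖v‖ = 1)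
    (hne : (p, u) ≠ (q, v)) : halfLine p u ∩ halfLine q v ⊆ {p, q} := by
  rintro w ⟨⟨t, ht, rfl⟩, ⟨s, hs, h⟩⟩
  subst hpq
  have h1 : (t : ℂ) * u = s * v := add_left_cancel h
  have h2 : t = s := by
    have := congrArg norm h1
    simpa [hu, hv, abs_of_nonneg ht, abs_of_nonneg hs] using this
  subst h2
  rcases eq_or_ne t 0 with rfl | h0
  · simp
  · exact absurd (by rw [mul_left_cancel₀ (Complex.ofReal_ne_zero.2 h0) h1]) hne

/-- The image of a bounded convex domain under a strictly nonexpansive perturbation of the identity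
is close-to-convex: the half-lines start at the images of the boundary points and point in the
directions of the outward normals. -/
theorem isCloseToConvexDomain_image_add {Ω : Set ℂ} (hconv : Convex ℝ Ω) (hopen : IsOpen Ω)
    (hne : Ω.Nonempty) (hbdd : Bornology.IsBounded Ω) {C : ℂ → ℂ}
    (hC : ∀ a ∈ Ω, ∀ b ∈ Ω, a ≠ b → ‖C a - C b‖ < ‖a - b‖)
    (himg : IsOpen ((fun w => w + C w) '' Ω)) :
    IsCloseToConvexDomain ((fun w => w + C w) '' Ω) := by
  have hLip : LipschitzOnWith 1 C Ω := LipschitzOnWith.of_dist_le_mul fun a ha b hb => by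
    rcases eq_or_ne a b with rfl | hab
    · simp
    · simpa [dist_eq_norm] using (hC a ha b hb hab).le
  obtain ⟨C', hC', heq⟩ := exists_lipschitzOnWith_closure hLip
  have hle : ∀ a ∈ closure Ω, ∀ b ∈ closure Ω, ‖C' a - C' b‖ ≤ ‖a - b‖ := fun a ha b hb => by
    simpa [dist_eq_norm] using hC'.dist_le_mul a ha b hb
  have hmono : ∀ a ∈ closure Ω, ∀ b ∈ closure Ω,
      inner ℝ ((a + C' a) - (b + C' b)) (a - b) ≤ 0 → a + C' a = b + C' b := fun a ha b hb h => by
    rw [add_sub_add_comm] at h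
    have := add_eq_add_of_inner_le_zero (hle a ha b hb) h
    rwa [← add_sub_add_comm, sub_eq_zero] at this
  -- strictness between an interior and a boundary point
  have hstrict : ∀ a ∈ Ω, ∀ b ∈ frontier Ω, 0 < inner ℝ ((a + C' a) - (b + C' b)) (a - b) := by
    intro a ha b hb
    have hbc := frontier_subset_closure hb
    have hbn : b ∉ Ω := fun h => by
      rw [hopen.frontier_eq] at hb; exact hb.2 h
    have hab : a ≠ b := fun h => hbn (h ▸ ha)
    -- Strict contraction is only known inside `Ω`. The midpoint lies in `Ω`, so the half from `a`
    -- to `m` contracts strictly and the half from `m` to `b` weakly.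
    set m : ℂ := (1 / 2 : ℝ) • a + (1 / 2 : ℝ) • b with hm
    have hmΩ : m ∈ Ω := by
      have := hconv.combo_interior_closure_mem_interior (hopen.interior_eq.symm ▸ ha) hbc
        (a := (1 / 2 : ℝ)) (b := 1 / 2) (by norm_num) (by norm_num) (by norm_num)
      rwa [hopen.interior_eq] at this
    have ham : a - m = (1 / 2 : ℝ) • (a - b) := by rw [hm]; module
    have hmb : m - b = (1 / 2 : ℝ) • (a - b) := by rw [hm]; module
    have hane : a ≠ m := fun h => hab (by simpa [sub_eq_zero.2 h, sub_eq_zero, eq_comm] using ham)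
    rw [add_sub_add_comm]
    apply inner_add_pos
    have e1 : ‖C' a - C' m‖ < ‖a - m‖ := by
      rw [heq ha, heq hmΩ]; exact hC a ha m hmΩ hane
    have e2 := hle m (subset_closure hmΩ) b hbc
    have e3 := norm_sub_le_norm_sub_add_norm_sub (C' a) (C' m) (C' b)
    rw [ham, norm_smul] at e1
    rw [hmb, norm_smul] at e2
    norm_num at e1 e2
    linarith
  have himg' : (fun w => w + C w) '' Ω = (fun w => w + C' w) '' Ω :=
    image_congr fun w hw => by simp only [heq hw]
  refine ⟨himg, (hconv.isConnected hne).image _ (continuousOn_id.add hLip.continuousOn),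
    {l | ∃ p ∈ frontier Ω, l.1 = p + C' p ∧ ‖l.2‖ = 1 ∧ ∀ w ∈ Ω, inner ℝ l.2 (w - p) ≤ 0},
    fun l hl => ?_, ?_, ?_⟩
  · obtain ⟨p, -, -, h, -⟩ := hl; exact h
  · rw [himg']
    ext v
    simp only [mem_compl_iff, mem_iUnion, exists_prop]
    constructor
    · intro hv
      obtain ⟨p, hp, hpv⟩ := exists_variational_ineq hbdd.isCompact_closure hconv.closure
        hne.closure hC' v
      have hpf : p ∈ frontier Ω := by
        rw [hopen.frontier_eq]
        refine ⟨hp, fun hpΩ => hv ⟨p, hpΩ, ?_⟩⟩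
        -- at an interior point the normal cone is trivial
        set n := v - C' p - p with hn
        have hev : ∀ᶠ t : ℝ in 𝓝[>] 0, p + t • n ∈ Ω := by
          have hc : ContinuousAt (fun t : ℝ => p + t • n) 0 := by fun_prop
          refine nhdsWithin_le_nhds (hc.eventually (hopen.mem_nhds ?_))
          simpa using hpΩ
        obtain ⟨t, htΩ, ht⟩ := (hev.and self_mem_nhdsWithin).exists
        have h1 := hpv _ (subset_closure htΩ)
        rw [add_sub_cancel_left, inner_smul_right, real_inner_self_eq_norm_sq] at h1
        have ht' : (0 : ℝ) < t := ht
        have h2 : ‖n‖ ^ 2 ≤ 0 := by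
          by_contra! h; exact absurd h1 (not_le.2 (mul_pos ht' h))
        have h3 : n = 0 := by simpa using le_antisymm h2 (by positivity)
        rw [hn] at h3
        linear_combination -h3
      have hpn : p ∉ Ω := fun h => by
        rw [hopen.frontier_eq] at hpf; exact hpf.2 h
      -- If the normal vector vanishes, `v` is itself an origin, and any supporting direction at `p`
      -- serves with parameter `0`.
      rcases eq_or_ne (v - C' p - p) 0 with h0 | h0
      · obtain ⟨φ, hφ⟩ := geometric_hahn_banach_open_point hconv hopen hpn
        set u := (InnerProductSpace.toDual ℝ ℂ).symm φ with hu
        have hu' : ∀ x, inner ℝ u x = φ x := fun x => InnerProductSpace.toDual_symm_apply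
        have hu0 : u ≠ 0 := by
          rintro h
          obtain ⟨x, hx⟩ := hne
          have := hφ x hx
          rw [← hu', ← hu', h, inner_zero_left, inner_zero_left] at this
          exact lt_irrefl _ this
        refine ⟨(p + C' p, (‖u‖⁻¹ : ℝ) • u), ⟨p, hpf, rfl, ?_, fun w hw => ?_⟩, 0, le_rfl, ?_⟩
        · simp [hu0]
        · rw [real_inner_smul_left, hu', map_sub]
          have := hφ w hw
          exact mul_nonpos_of_nonneg_of_nonpos (by positivity) (by linarith)
        · simp only [Complex.ofReal_zero, zero_mul, add_zero]
          linear_combination h0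
      · refine ⟨(p + C' p, (‖v - C' p - p‖⁻¹ : ℝ) • (v - C' p - p)),
          ⟨p, hpf, rfl, ?_, fun w hw => ?_⟩, ‖v - C' p - p‖, norm_nonneg _, ?_⟩
        · simp only [norm_smul, norm_inv, norm_norm]
          exact inv_mul_cancel₀ (norm_ne_zero_iff.2 h0)
        · rw [real_inner_smul_left]
          exact mul_nonpos_of_nonneg_of_nonpos (by positivity) (hpv w (subset_closure hw))
        · rw [← Complex.real_smul, smul_smul, mul_inv_cancel₀ (norm_ne_zero_iff.2 h0), one_smul]
          ring
    -- An image point on a half-line would differ from its origin by a nonnegative multiple of an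
    -- outward normal at `p`, contradicting `hstrict`.
    · rintro ⟨l, ⟨p, hp, h1, -, hl⟩, t, ht, rfl⟩ ⟨w, hw, h⟩
      have h3 := hstrict w hw p hp
      have h4 : (w + C' w) - (p + C' p) = t • l.2 := by
        rw [← h1, Complex.real_smul]; simp only at h; rw [h]; ring
      rw [h4, real_inner_smul_left] at h3
      exact absurd h3 (not_lt.2 (mul_nonpos_of_nonneg_of_nonpos ht (hl w hw)))
  · rintro ⟨lp, lu⟩ ⟨p, hp, h1, h2, h3⟩ ⟨mq, mv⟩ ⟨q, hq, k1, k2, k3⟩ hlm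
    simp only at h1 h2 h3 k1 k2 k3
    rintro x hx
    refine halfLine_inter_subset_origin ?_ h2 k2 hlm hx
    obtain ⟨⟨t, ht, rfl⟩, ⟨s, hs, h⟩⟩ := hx
    have hcl : ∀ {u y : ℂ}, (∀ w ∈ Ω, inner ℝ u (w - y) ≤ 0) →
        ∀ w ∈ closure Ω, inner ℝ u (w - y) ≤ 0 := fun {u y} hu w hw => by
      have hc : IsClosed {w : ℂ | inner ℝ u (w - y) ≤ 0} :=
        isClosed_le (by fun_prop) continuous_const
      exact closure_minimal hu hc hw
    have hpc := frontier_subset_closure hp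
    have hqc := frontier_subset_closure hq
    rw [h1, k1]
    -- At a common point, the two normal inequalities make the monotonicity product nonpositive,
    -- which is the equality case: the origins coincide.
    apply hmono p hpc q hqc
    have e : (p + C' p) - (q + C' q) = s • mv - t • lu := by
      rw [← h1, ← k1, Complex.real_smul, Complex.real_smul]; linear_combination h
    have e1 := hcl h3 q hqc
    have e2 := hcl k3 p hpc
    rw [e, inner_sub_left, real_inner_smul_left, real_inner_smul_left]
    rw [← neg_sub, inner_neg_right] at e1
    linarith [mul_nonpos_of_nonneg_of_nonpos hs e2, mul_nonneg ht (neg_nonpos.1 e1)]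

end Rays

/-! ### Univalence of the analytic part -/

section Injective

/-- The Noshiro–Warschawski theorem. -/
theorem injOn_of_re_deriv_pos {S : Set ℂ} (hS : Convex ℝ S) {F F' : ℂ → ℂ}
    (hF : ∀ z ∈ S, HasDerivAt F (F' z) z) (hpos : ∀ z ∈ S, 0 < (F' z).re) : InjOn F S := by
  intro a ha b hb hab
  by_contra hne
  have hc : b - a ≠ 0 := sub_ne_zero.2 (Ne.symm hne)
  have hmem : ∀ t ∈ Icc (0 : ℝ) 1, a + t * (b - a) ∈ S := fun t ht => by
    have := hS.add_smul_sub_mem ha hb ht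
    simpa using this
  -- The component of `F` in the direction `b - a` strictly increases along the segment.
  have hder : ∀ t ∈ Icc (0 : ℝ) 1, HasDerivAt (fun t : ℝ => (conj (b - a) * F (a + t * (b - a))).re)
      (Complex.normSq (b - a) * (F' (a + t * (b - a))).re) t := fun t ht => by
    have h1 : HasDerivAt (fun s : ℂ => a + s * (b - a)) (b - a) (t : ℂ) := by
      simpa using ((hasDerivAt_id (t : ℂ)).mul_const (b - a)).const_add a
    have h2 := (((hF _ (hmem t ht)).comp (t : ℂ) h1).const_mul (conj (b - a))).real_of_complex
    refine h2.congr_deriv ?_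
    rw [← Complex.re_ofReal_mul, Complex.normSq_eq_conj_mul_self]
    congr 1; ring
  have hmono : StrictMonoOn (fun t : ℝ => (conj (b - a) * F (a + t * (b - a))).re) (Icc 0 1) := by
    refine strictMonoOn_of_deriv_pos (convex_Icc 0 1)
      (fun t ht => (hder t ht).continuousAt.continuousWithinAt) fun t ht => ?_
    have ht' := interior_subset ht
    rw [(hder t ht').deriv]
    exact mul_pos (Complex.normSq_pos.2 hc) (hpos _ (hmem t ht'))
  have h01 := hmono (left_mem_Icc.2 zero_le_one) (right_mem_Icc.2 zero_le_one) zero_lt_one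
  simp [hab] at h01

theorem concaveOn_log_cos :
    ConcaveOn ℝ (Ioo (-(Real.pi / 2)) (Real.pi / 2)) (fun y => Real.log (Real.cos y)) := by
  refine ⟨convex_Ioo _ _, fun x hx y hy a b ha hb hab => ?_⟩
  have hcx := Real.cos_pos_of_mem_Ioo hx
  have hcy := Real.cos_pos_of_mem_Ioo hy
  have h1 := strictConcaveOn_log_Ioi.concaveOn.2 (mem_Ioi.2 hcx) (mem_Ioi.2 hcy) ha hb hab
  have h2 := strictConcaveOn_cos_Icc.concaveOn.2 (Ioo_subset_Icc_self hx) (Ioo_subset_Icc_self hy)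
    ha hb hab
  have h3 : 0 < a • Real.cos x + b • Real.cos y :=
    convex_Ioi (0 : ℝ) (mem_Ioi.2 hcx) (mem_Ioi.2 hcy) ha hb hab
  exact h1.trans (Real.log_le_log h3 h2)

/-- The image of the unit disk under `z ↦ -log (1 - z)`. -/
def logDomain : Set ℂ :=
  {ζ | ζ.im ∈ Ioo (-(Real.pi / 2)) (Real.pi / 2) ∧ -ζ.re < Real.log 2 + Real.log (Real.cos ζ.im)}

theorem convex_logDomain : Convex ℝ logDomain := by
  rintro x ⟨hx, hx'⟩ y ⟨hy, hy'⟩ a b ha hb hab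
  refine ⟨?_, ?_⟩
  · simpa using convex_Ioo _ _ hx hy ha hb hab
  · have h := concaveOn_log_cos.2 hx hy ha hb hab
    simp only [smul_eq_mul] at h
    simp only [Complex.add_re, Complex.add_im, Complex.real_smul, Complex.re_ofReal_mul,
      Complex.im_ofReal_mul]
    have h2 : Real.log 2 = a * Real.log 2 + b * Real.log 2 := by rw [← add_mul, hab, one_mul]
    -- A strict inequality survives averaging only through a positive weight, so `a = 0` is
    -- separate.
    rcases ha.eq_or_lt with rfl | ha'
    · obtain rfl : b = 1 := by linarith
      nlinarith
    · nlinarith [mul_lt_mul_of_pos_left hx' ha', mul_le_mul_of_nonneg_left hy'.le hb]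

/-- With `ζ = x + iy`, `|1 - e^{-ζ}|² = 1 + e^{-x}(e^{-x} - 2 cos y)`. -/
theorem mem_logDomain_iff {ζ : ℂ} (hζ : ζ.im ∈ Ioo (-(Real.pi / 2)) (Real.pi / 2)) :
    ζ ∈ logDomain ↔ 1 - Complex.exp (-ζ) ∈ unitDisk := by
  have hc := Real.cos_pos_of_mem_Ioo hζ
  have he := Real.exp_pos (-ζ.re)
  have h1 : ζ ∈ logDomain ↔ Real.exp (-ζ.re) < 2 * Real.cos ζ.im := by
    simp only [logDomain, mem_ofPred_eq, hζ, true_and]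
    rw [← Real.log_mul (by norm_num) hc.ne', Real.lt_log_iff_exp_lt (by positivity)]
  have h2 : ‖1 - Complex.exp (-ζ)‖ ^ 2
      = 1 + Real.exp (-ζ.re) * (Real.exp (-ζ.re) - 2 * Real.cos ζ.im) := by
    rw [← Complex.normSq_eq_norm_sq, Complex.normSq_apply]
    simp only [Complex.sub_re, Complex.sub_im, Complex.one_re, Complex.one_im, Complex.exp_re,
      Complex.exp_im, Complex.neg_re, Complex.neg_im, Real.cos_neg, Real.sin_neg]
    linear_combination Real.exp (-ζ.re) ^ 2 * Real.sin_sq_add_cos_sq ζ.im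
  rw [h1, unitDisk, mem_ball_zero_iff, ← sq_lt_one_iff₀ (norm_nonneg _), h2]
  constructor
  · intro h; nlinarith
  · intro h
    by_contra! h'
    nlinarith [mul_nonneg he.le (sub_nonneg.2 h')]

/-- Under `z = 1 - e^{-ζ}` one has `dz/dζ = 1 - z`, so Noshiro–Warschawski applies on the convex
`logDomain`. -/
theorem injOn_of_re_one_sub_mul_deriv_pos {h : ℂ → ℂ} (ha : AnalyticOnNhd ℂ h unitDisk)
    (hpos : ∀ z ∈ unitDisk, 0 < ((1 - z) * deriv h z).re) : InjOn h unitDisk := by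
  have hinj : InjOn (fun ζ => h (1 - Complex.exp (-ζ))) logDomain := by
    refine injOn_of_re_deriv_pos convex_logDomain
      (F' := fun ζ => (1 - (1 - Complex.exp (-ζ))) * deriv h (1 - Complex.exp (-ζ)))
      (fun ζ hζ => ?_) fun ζ hζ => hpos _ ((mem_logDomain_iff hζ.1).1 hζ)
    have h1 : HasDerivAt (fun ζ => 1 - Complex.exp (-ζ)) (Complex.exp (-ζ)) ζ := by
      simpa using ((hasDerivAt_neg ζ).cexp).const_sub 1
    have h2 := ((ha _ ((mem_logDomain_iff hζ.1).1 hζ)).differentiableAt.hasDerivAt).comp ζ h1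
    exact h2.congr_deriv (by ring)
  have hlog : ∀ z ∈ unitDisk, -Complex.log (1 - z) ∈ logDomain
      ∧ 1 - Complex.exp (-(-Complex.log (1 - z))) = z := fun z hz => by
    have hre : 0 < (1 - z).re := by
      have h1 := Complex.re_le_norm z
      have h2 : ‖z‖ < 1 := mem_ball_zero_iff.1 hz
      simp only [Complex.sub_re, Complex.one_re]
      linarith
    have hne : 1 - z ≠ 0 := fun h => by simp [h] at hre
    have hexp : 1 - Complex.exp (-(-Complex.log (1 - z))) = z := by
      rw [neg_neg, Complex.exp_log hne]; ring
    refine ⟨(mem_logDomain_iff ?_).2 (by rwa [hexp]), hexp⟩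
    have := abs_lt.1 (Complex.abs_arg_lt_pi_div_two_iff.2 (Or.inl hre))
    simp only [Complex.neg_im, Complex.log_im, mem_Ioo]
    constructor <;> linarith [this.1, this.2]
  intro x hx y hy hxy
  have := hinj (hlog x hx).1 (hlog y hy).1
    (by simpa only [(hlog x hx).2, (hlog y hy).2] using hxy)
  rw [← (hlog x hx).2, ← (hlog y hy).2, this]

end Injective

/-! ### Convexity of the image of the analytic part -/

section Convex

theorem hasDerivAt_invFunOn {U : Set ℂ} (hU : IsOpen U) {h : ℂ → ℂ} (ha : AnalyticOnNhd ℂ h U)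
    (hinj : InjOn h U) (hd : ∀ z ∈ U, deriv h z ≠ 0) {z : ℂ} (hz : z ∈ U) :
    HasDerivAt (Function.invFunOn h U) (deriv h z)⁻¹ (h z) := by
  have h1 : HasStrictDerivAt h (deriv h z) z := (ha z hz).hasStrictDerivAt
  refine (h1.to_local_left_inverse (hd z hz) ?_).hasDerivAt
  filter_upwards [hU.mem_nhds hz] with x hx using hinj.leftInvOn_invFunOn hx

theorem isOpen_image_of_deriv_ne_zero {U : Set ℂ} (hU : IsOpen U) {h : ℂ → ℂ}
    (ha : AnalyticOnNhd ℂ h U) (hd : ∀ z ∈ U, deriv h z ≠ 0) : IsOpen (h '' U) := by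
  rw [isOpen_iff_mem_nhds]
  rintro _ ⟨z, hz, rfl⟩
  rw [← (ha z hz).hasStrictDerivAt.map_nhds_eq (hd z hz)]
  exact image_mem_map (hU.mem_nhds hz)

/-- Along a segment in the image, the preimage stays in the smallest centred disk containing the
preimages of the endpoints, provided `1 + z h'' / h'` has positive real part. -/
theorem norm_invFunOn_le_max {h : ℂ → ℂ} (ha : AnalyticOnNhd ℂ h unitDisk)
    (hinj : InjOn h unitDisk) (hd : ∀ z ∈ unitDisk, deriv h z ≠ 0)
    (hpos : ∀ z ∈ unitDisk, 0 < ((deriv h z + z * deriv (deriv h) z) / deriv h z).re)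
    {p q : ℂ} (hpq : ∀ t ∈ Icc (0 : ℝ) 1, p + t * (q - p) ∈ h '' unitDisk)
    {t : ℝ} (ht : t ∈ Icc (0 : ℝ) 1) :
    ‖Function.invFunOn h unitDisk (p + t * (q - p))‖
      ≤ max ‖Function.invFunOn h unitDisk p‖ ‖Function.invFunOn h unitDisk q‖ := by
  have hU : IsOpen unitDisk := isOpen_ball
  set c := q - p with hc
  set H := Function.invFunOn h unitDisk with hH
  set ζ : ℝ → ℂ := fun t => H (p + t * c) with hζ
  have hmem : ∀ t ∈ Icc (0 : ℝ) 1, ζ t ∈ unitDisk ∧ h (ζ t) = p + t * c := fun t ht =>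
    ⟨Function.invFunOn_mem (hpq t ht), Function.invFunOn_eq (hpq t ht)⟩
  have hζd : ∀ t ∈ Icc (0 : ℝ) 1, HasDerivAt ζ (c / deriv h (ζ t)) t := fun t ht => by
    have h1 := hasDerivAt_invFunOn hU ha hinj hd (hmem t ht).1
    rw [(hmem t ht).2] at h1
    have h2 : HasDerivAt (fun s : ℂ => p + s * c) c (t : ℂ) := by
      simpa using ((hasDerivAt_id (t : ℂ)).mul_const c).const_add p
    have h3 := (h1.comp (t : ℂ) h2).comp_ofReal
    refine h3.congr_deriv ?_
    rw [div_eq_inv_mul]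
  -- `χ` carries the sign of the derivative of `‖ζ‖²`, and its own derivative is `|c|² Re (1 +
  -- zh''/h')`.
  set χ : ℝ → ℝ := fun t => (conj c * (ζ t * deriv h (ζ t))).re with hχ
  have hχd : ∀ t ∈ Icc (0 : ℝ) 1, HasDerivAt χ
      (Complex.normSq c * ((deriv h (ζ t) + ζ t * deriv (deriv h) (ζ t)) / deriv h (ζ t)).re) t :=
    fun t ht => by
    have hz := (hmem t ht).1
    have h1 := ((hasDerivAt_id (ζ t)).mul
      ((ha.deriv _ hz).differentiableAt.hasDerivAt)).const_mul (conj c)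
    have h2 := h1.scomp t (hζd t ht)
    have h3 := Complex.reCLM.hasFDerivAt.comp_hasDerivAt t h2
    refine h3.congr_deriv ?_
    rw [← Complex.re_ofReal_mul, Complex.normSq_eq_conj_mul_self]
    simp only [Complex.reCLM_apply, id, smul_eq_mul]
    congr 1; ring
  have hψd : ∀ t ∈ Icc (0 : ℝ) 1, HasDerivAt (fun t => ‖ζ t‖ ^ 2)
      (2 * χ t / Complex.normSq (deriv h (ζ t))) t := fun t ht => by
    have h1 := (hζd t ht).norm_sq
    convert h1 using 1
    have h2 := hd _ (hmem t ht).1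
    rw [mul_div_assoc]
    congr 1
    rw [Complex.inner, div_eq_mul_inv, div_eq_mul_inv, Complex.inv_def]
    have e1 : conj (ζ t) * (c * (conj (deriv h (ζ t)) * ((Complex.normSq (deriv h (ζ t)))⁻¹ : ℝ)))
        = ((Complex.normSq (deriv h (ζ t)))⁻¹ : ℝ) * conj (conj c * (ζ t * deriv h (ζ t))) := by
      simp only [map_mul, Complex.conj_conj]; ring
    rw [mul_comm (c * _), e1, Complex.re_ofReal_mul, Complex.conj_re, mul_comm]
  have hχm : MonotoneOn χ (Icc 0 1) := by
    refine monotoneOn_of_deriv_nonneg (convex_Icc 0 1)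
      (fun t ht => (hχd t ht).continuousAt.continuousWithinAt)
      (fun t ht => (hχd t (interior_subset ht)).differentiableAt.differentiableWithinAt)
      fun t ht => ?_
    rw [(hχd t (interior_subset ht)).deriv]
    exact mul_nonneg (Complex.normSq_nonneg _) (hpos _ (hmem t (interior_subset ht)).1).le
  have h0 : ζ 0 = H p := by simp [hζ]
  have h1 : ζ 1 = H q := by simp [hζ, hc]
  change ‖ζ t‖ ≤ _
  rw [← h0, ← h1]
  have hd0 : ∀ s ∈ Icc (0 : ℝ) 1, deriv (fun t => ‖ζ t‖ ^ 2) s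
      = 2 * χ s / Complex.normSq (deriv h (ζ s)) := fun s hs => (hψd s hs).deriv
  -- Since `χ` is monotone, `‖ζ‖²` decreases on `[0, t]` or increases on `[t, 1]`.
  rcases le_total (χ t) 0 with hneg | hnn
  · have hsub : Icc 0 t ⊆ Icc (0 : ℝ) 1 := Icc_subset_Icc_right ht.2
    have hanti : AntitoneOn (fun t => ‖ζ t‖ ^ 2) (Icc 0 t) := by
      refine antitoneOn_of_deriv_nonpos (convex_Icc 0 t)
        (fun s hs => (hψd s (hsub hs)).continuousAt.continuousWithinAt)
        (fun s hs => (hψd s (hsub (interior_subset hs))).differentiableAt.differentiableWithinAt)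
        fun s hs => ?_
      have hs' := interior_subset hs
      rw [hd0 s (hsub hs')]
      have := hχm (hsub hs') ht hs'.2
      exact div_nonpos_of_nonpos_of_nonneg (by linarith) (Complex.normSq_nonneg _)
    have := hanti (left_mem_Icc.2 ht.1) (right_mem_Icc.2 ht.1) ht.1
    exact le_max_of_le_left (le_of_sq_le_sq this (norm_nonneg _))
  · have hsub : Icc t 1 ⊆ Icc (0 : ℝ) 1 := Icc_subset_Icc_left ht.1
    have hmono : MonotoneOn (fun t => ‖ζ t‖ ^ 2) (Icc t 1) := by
      refine monotoneOn_of_deriv_nonneg (convex_Icc t 1)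
        (fun s hs => (hψd s (hsub hs)).continuousAt.continuousWithinAt)
        (fun s hs => (hψd s (hsub (interior_subset hs))).differentiableAt.differentiableWithinAt)
        fun s hs => ?_
      have hs' := interior_subset hs
      rw [hd0 s (hsub hs')]
      have := hχm ht (hsub hs') hs'.1
      exact div_nonneg (by linarith) (Complex.normSq_nonneg _)
    have := hmono (left_mem_Icc.2 ht.2) (right_mem_Icc.2 ht.2) ht.2
    exact le_max_of_le_right (le_of_sq_le_sq this (norm_nonneg _))

/-- A univalent function for which `1 + z h'' / h'` has positive real part is convex. -/
theorem convex_image_unitDisk {h : ℂ → ℂ} (ha : AnalyticOnNhd ℂ h unitDisk)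
    (hinj : InjOn h unitDisk) (hd : ∀ z ∈ unitDisk, deriv h z ≠ 0)
    (hpos : ∀ z ∈ unitDisk, 0 < ((deriv h z + z * deriv (deriv h) z) / deriv h z).re) :
    Convex ℝ (h '' unitDisk) := by
  have hU : IsOpen unitDisk := isOpen_ball
  have hΩ : IsOpen (h '' unitDisk) := isOpen_image_of_deriv_ne_zero hU ha hd
  -- Continuity method: the pairs whose image segment stays in the image form a nonempty, open and
  -- relatively closed subset of the connected bidisk.
  set A : Set (ℂ × ℂ) := {x | x ∈ unitDisk ×ˢ unitDisk ∧
    ∀ t ∈ Icc (0 : ℝ) 1, h x.1 + t * (h x.2 - h x.1) ∈ h '' unitDisk} with hA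
  have hcont : ∀ x ∈ unitDisk ×ˢ unitDisk, ∀ t : ℝ, ContinuousAt
      (fun y : (ℂ × ℂ) × ℝ => h y.1.1 + y.2 * (h y.1.2 - h y.1.1)) (x, t) := fun x hx t => by
    have h1 : ContinuousAt (fun y : (ℂ × ℂ) × ℝ => h y.1.1) (x, t) :=
      ContinuousAt.comp (g := h) (ha _ hx.1).continuousAt (by fun_prop)
    have h2 : ContinuousAt (fun y : (ℂ × ℂ) × ℝ => h y.1.2) (x, t) :=
      ContinuousAt.comp (g := h) (ha _ hx.2).continuousAt (by fun_prop)
    exact h1.add (ContinuousAt.mul (by fun_prop) (h2.sub h1))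
  have hAo : IsOpen A := by
    rw [isOpen_iff_mem_nhds]
    rintro x ⟨hx, hxt⟩
    have h1 := isCompact_Icc.eventually_forall_of_forall_eventually (x₀ := x) (K := Icc (0 : ℝ) 1)
      (P := fun y t => h y.1 + t * (h y.2 - h y.1) ∈ h '' unitDisk)
      fun t ht => (hcont x hx t).eventually (hΩ.mem_nhds (hxt t ht))
    filter_upwards [h1, (hU.prod hU).mem_nhds hx] with y hy hy' using ⟨hy', hy⟩
  have hconn : IsPreconnected (unitDisk ×ˢ unitDisk) :=
    ((convex_ball (0 : ℂ) 1).isPreconnected).prod (convex_ball (0 : ℂ) 1).isPreconnected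
  have h0 : (0 : ℂ) ∈ unitDisk := by simp [unitDisk]
  have hcl : closure A ∩ unitDisk ×ˢ unitDisk ⊆ A := by
    rintro x ⟨hxA, hx⟩
    refine ⟨hx, fun t ht => ?_⟩
    have hx1 : ‖x.1‖ < 1 := mem_ball_zero_iff.1 hx.1
    have hx2 : ‖x.2‖ < 1 := mem_ball_zero_iff.1 hx.2
    -- For nearby pairs in `A`, `norm_invFunOn_le_max` traps the segments in the compact image of
    -- the disk of radius `ρ`, so the limit segment stays there too.
    obtain ⟨ρ, hρ, hρ1⟩ := exists_between (max_lt hx1 hx2)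
    have hsub : closedBall (0 : ℂ) ρ ⊆ unitDisk := closedBall_subset_ball hρ1
    have hK : IsClosed (h '' closedBall (0 : ℂ) ρ) :=
      ((isCompact_closedBall _ _).image_of_continuousOn (ha.continuousOn.mono hsub)).isClosed
    have hlim : ContinuousAt (fun y : ℂ × ℂ => h y.1 + t * (h y.2 - h y.1)) x :=
      ContinuousAt.comp (f := fun y : ℂ × ℂ => (y, t))
        (g := fun y : (ℂ × ℂ) × ℝ => h y.1.1 + y.2 * (h y.1.2 - h y.1.1)) (hcont x hx t)
        (by fun_prop)
    have hev : ∀ᶠ y : ℂ × ℂ in 𝓝 x, ‖y.1‖ < ρ ∧ ‖y.2‖ < ρ := by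
      have e1 : ContinuousAt (fun y : ℂ × ℂ => ‖y.1‖) x := by fun_prop
      have e2 : ContinuousAt (fun y : ℂ × ℂ => ‖y.2‖) x := by fun_prop
      exact (e1.eventually (gt_mem_nhds ((le_max_left _ _).trans_lt hρ))).and
        (e2.eventually (gt_mem_nhds ((le_max_right _ _).trans_lt hρ)))
    refine image_mono hsub (hK.mem_of_frequently_of_tendsto
      (((mem_closure_iff_frequently.1 hxA).and_eventually hev).mono ?_) hlim)
    rintro y ⟨⟨hy, hyt⟩, hy1, hy2⟩
    refine ⟨_, mem_closedBall_zero_iff.2 ?_, Function.invFunOn_eq (hyt t ht)⟩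
    refine (norm_invFunOn_le_max ha hinj hd hpos hyt ht).trans (max_le ?_ ?_)
    · rw [hinj.leftInvOn_invFunOn hy.1]; exact hy1.le
    · rw [hinj.leftInvOn_invFunOn hy.2]; exact hy2.le
  have hall := hconn.subset_of_closure_inter_subset hAo
    ⟨(0, 0), ⟨h0, h0⟩, ⟨h0, h0⟩, fun t _ => ⟨0, h0, by simp⟩⟩ hcl
  rintro _ ⟨x, hx, rfl⟩ _ ⟨y, hy, rfl⟩ a b ha' hb' hab
  have := (hall (show (x, y) ∈ unitDisk ×ˢ unitDisk from ⟨hx, hy⟩)).2 b ⟨hb', by linarith⟩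
  convert this using 1
  obtain rfl : a = 1 - b := by linarith
  simp only [Complex.real_smul]
  push_cast
  ring

end Convex

/-! ### From the coefficient sum to estimates in the disk -/

section Coefficients

theorem hasSum_of_eq {f g : ℕ → ℂ} {a b : ℂ} (h : HasSum f a) (hfg : ∀ n, g n = f n)
    (hab : b = a) : HasSum g b := by
  rw [hab, funext hfg]; exact h

theorem norm_le_tsum_norm_mul {c : ℕ → ℂ} {z S : ℂ} (hz : ‖z‖ ≤ 1) (hc : Summable fun n => ‖c n‖)
    (hS : HasSum (fun n => c n * z ^ (n + 1)) S) : ‖S‖ ≤ (∑' n, ‖c n‖) * ‖z‖ := by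
  rw [← hS.tsum_eq]
  refine tsum_of_norm_bounded (hc.hasSum.mul_right ‖z‖) fun n => ?_
  rw [norm_mul, norm_pow]
  refine mul_le_mul_of_nonneg_left ?_ (norm_nonneg _)
  simpa using pow_le_pow_of_le_one (norm_nonneg z) hz (Nat.le_add_left 1 n)

theorem hasSum_coeff {h : ℂ → ℂ} (ha : AnalyticOnNhd ℂ h unitDisk) {z : ℂ} (hz : z ∈ unitDisk) :
    HasSum (fun n => coeff h n * z ^ n) (h z) := by
  have h1 := Complex.hasSum_taylorSeries_on_ball (c := 0) (r := 1) ha.differentiableOn hz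
  refine hasSum_of_eq h1 (fun n => ?_) rfl
  rw [coeff, sub_zero, smul_eq_mul, smul_eq_mul]
  ring

theorem coeff_deriv (h : ℂ → ℂ) (n : ℕ) : coeff (deriv h) n = (n + 1) * coeff h (n + 1) := by
  have h1 : ((n.factorial : ℕ) : ℂ) ≠ 0 := Nat.cast_ne_zero.2 n.factorial_ne_zero
  have h2 : (n : ℂ) + 1 ≠ 0 := Nat.cast_add_one_ne_zero n
  rw [coeff, coeff, iteratedDeriv_succ', Nat.factorial_succ]
  push_cast
  field_simp

/-- The factor `1 - z` turns coefficients into consecutive differences, the source of the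
differences in `coeffTerm`. -/
theorem hasSum_one_sub_mul {c : ℕ → ℂ} {z S : ℂ} (hS : HasSum (fun n => c n * z ^ n) S) :
    HasSum (fun n => (c (n + 1) - c n) * z ^ (n + 1)) ((1 - z) * S - c 0) := by
  have h1 := ((hasSum_nat_add_iff' 1).2 hS).sub (hS.mul_left z)
  refine hasSum_of_eq h1 (fun n => ?_) ?_
  · ring
  · simp; ring

theorem hasSum_mul_deriv_deriv {h : ℂ → ℂ} (ha : AnalyticOnNhd ℂ h unitDisk) {z : ℂ}
    (hz : z ∈ unitDisk) :
    HasSum (fun n : ℕ => ((n + 1) * n * coeff h (n + 1)) * z ^ n) (z * deriv (deriv h) z) := by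
  have h1 := (hasSum_coeff ha.deriv.deriv hz).mul_left z
  have h2 : z * deriv (deriv h) z = z * deriv (deriv h) z - ∑ i ∈ Finset.range 1,
      (((i : ℂ) + 1) * i * coeff h (i + 1)) * z ^ i := by simp
  rw [← hasSum_nat_add_iff' 1, ← h2]
  refine hasSum_of_eq h1 (fun n => ?_) rfl
  rw [coeff_deriv, coeff_deriv]
  push_cast
  ring

variable {h : ℂ → ℂ} {z : ℂ}

theorem hasSum_one_sub_mul_two_deriv_add (ha : AnalyticOnNhd ℂ h unitDisk) (h1 : deriv h 0 = 1)
    (hz : z ∈ unitDisk) :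
    HasSum (fun m : ℕ => (((m + 2 : ℕ) : ℂ) * ((((m + 2 : ℕ) : ℂ) + 1) * coeff h (m + 2)
        - (((m + 2 : ℕ) : ℂ) - 1) * coeff h (m + 1))) * z ^ (m + 1))
      ((1 - z) * (2 * deriv h z + z * deriv (deriv h) z) - 2) := by
  have e1 : HasSum (fun n : ℕ => ((n + 2) * (n + 1) * coeff h (n + 1)) * z ^ n)
      (2 * deriv h z + z * deriv (deriv h) z) := by
    refine hasSum_of_eq (((hasSum_coeff ha.deriv hz).mul_left 2).add (hasSum_mul_deriv_deriv ha hz))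
      (fun n => ?_) rfl
    rw [coeff_deriv]; ring
  have e0 : coeff h 1 = 1 := by simp [coeff, h1]
  refine hasSum_of_eq (hasSum_one_sub_mul e1) (fun m => ?_) ?_
  · push_cast; ring
  · simp [e0]

theorem hasSum_one_sub_mul_mul_deriv_deriv (ha : AnalyticOnNhd ℂ h unitDisk)
    (hz : z ∈ unitDisk) :
    HasSum (fun m : ℕ => ((((m + 2 : ℕ) : ℂ) - 1) * (((m + 2 : ℕ) : ℂ) * coeff h (m + 2)
        - (((m + 2 : ℕ) : ℂ) - 2) * coeff h (m + 1))) * z ^ (m + 1))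
      ((1 - z) * (z * deriv (deriv h) z)) := by
  refine hasSum_of_eq (hasSum_one_sub_mul (hasSum_mul_deriv_deriv ha hz)) (fun m => ?_) ?_
  · push_cast; ring
  · simp

theorem hasSum_coeffTerm_add_two {a : ℕ → ℂ} (hsum : Summable fun n : {n : ℕ // 2 ≤ n} =>
      coeffTerm a n) :
    HasSum (fun m : ℕ => coeffTerm a (m + 2)) (∑' n : {n : ℕ // 2 ≤ n}, coeffTerm a n) := by
  let e : ℕ ≃ {n : ℕ // 2 ≤ n} := ⟨fun m => ⟨m + 2, by omega⟩, fun n => n - 2, fun m => by simp,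
    fun n => Subtype.ext (Nat.sub_add_cancel n.2)⟩
  exact e.hasSum_iff.2 hsum.hasSum

/-- The two parts of `coeffTerm`. -/
theorem coeffTerm_add_two (a : ℕ → ℂ) (m : ℕ) : coeffTerm a (m + 2)
    = ‖((m + 2 : ℕ) : ℂ) * ((((m + 2 : ℕ) : ℂ) + 1) * a (m + 2)
        - (((m + 2 : ℕ) : ℂ) - 1) * a (m + 1))‖
      + ‖(((m + 2 : ℕ) : ℂ) - 1) * (((m + 2 : ℕ) : ℂ) * a (m + 2)
        - (((m + 2 : ℕ) : ℂ) - 2) * a (m + 1))‖ := by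
  have e : (((m + 2 : ℕ) : ℂ) - 1) = ((m + 1 : ℕ) : ℂ) := by push_cast; ring
  have e' : (((m + 2 : ℕ) : ℝ) - 1) = ((m + 1 : ℕ) : ℝ) := by push_cast; ring
  rw [coeffTerm, norm_mul, norm_mul, Complex.norm_natCast, e', show m + 2 - 1 = m + 1 from rfl, e,
    Complex.norm_natCast]

/-- Neither series has a constant term, so each is at most `|z|` times the sum of its coefficient
moduli; these two sums add up to the sum of `coeffTerm`. -/
theorem norm_add_norm_le_two_mul (ha : AnalyticOnNhd ℂ h unitDisk) (h1 : deriv h 0 = 1)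
    (hsum : Summable fun n : {n : ℕ // 2 ≤ n} => coeffTerm (coeff h) n)
    (hle : ∑' n : {n : ℕ // 2 ≤ n}, coeffTerm (coeff h) n ≤ 2) (hz : z ∈ unitDisk) :
    ‖(1 - z) * (2 * deriv h z + z * deriv (deriv h) z) - 2‖
      + ‖(1 - z) * (z * deriv (deriv h) z)‖ ≤ 2 * ‖z‖ := by
  have hS := hasSum_coeffTerm_add_two hsum
  have hA := hasSum_one_sub_mul_two_deriv_add ha h1 hz
  have hB := hasSum_one_sub_mul_mul_deriv_deriv ha hz
  have hz1 : ‖z‖ ≤ 1 := (mem_ball_zero_iff.1 hz).le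
  have hAs : Summable fun m : ℕ => ‖((m + 2 : ℕ) : ℂ) * ((((m + 2 : ℕ) : ℂ) + 1) * coeff h (m + 2)
        - (((m + 2 : ℕ) : ℂ) - 1) * coeff h (m + 1))‖ :=
    Summable.of_nonneg_of_le (fun _ => norm_nonneg _)
      (fun m => by rw [coeffTerm_add_two]; exact le_add_of_nonneg_right (norm_nonneg _)) hS.summable
  have hBs : Summable fun m : ℕ => ‖(((m + 2 : ℕ) : ℂ) - 1) * (((m + 2 : ℕ) : ℂ) * coeff h (m + 2)
        - (((m + 2 : ℕ) : ℂ) - 2) * coeff h (m + 1))‖ :=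
    Summable.of_nonneg_of_le (fun _ => norm_nonneg _)
      (fun m => by rw [coeffTerm_add_two]; exact le_add_of_nonneg_left (norm_nonneg _)) hS.summable
  have e1 := norm_le_tsum_norm_mul hz1 hAs hA
  have e2 := norm_le_tsum_norm_mul hz1 hBs hB
  have e3 := hAs.hasSum.add hBs.hasSum
  simp_rw [← coeffTerm_add_two] at e3
  have e4 := e3.unique hS
  have e5 := mul_le_mul_of_nonneg_right (e4.trans_le hle) (norm_nonneg z)
  linarith

theorem re_one_sub_mul_deriv_pos (ha : AnalyticOnNhd ℂ h unitDisk) (h1 : deriv h 0 = 1)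
    (hsum : Summable fun n : {n : ℕ // 2 ≤ n} => coeffTerm (coeff h) n)
    (hle : ∑' n : {n : ℕ // 2 ≤ n}, coeffTerm (coeff h) n ≤ 2) (hz : z ∈ unitDisk) :
    0 < ((1 - z) * deriv h z).re := by
  have h2 := norm_add_norm_le_two_mul ha h1 hsum hle hz
  have hz1 : ‖z‖ < 1 := mem_ball_zero_iff.1 hz
  have h3 := Complex.re_le_norm ((1 - z) * (z * deriv (deriv h) z))
  have h4 := (abs_le.1 (Complex.abs_re_le_norm
    ((1 - z) * (2 * deriv h z + z * deriv (deriv h) z) - 2))).1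
  have h5 : ((1 - z) * (2 * deriv h z + z * deriv (deriv h) z) - 2).re
      = 2 * ((1 - z) * deriv h z).re + ((1 - z) * (z * deriv (deriv h) z)).re - 2 := by
    rw [show (1 - z) * (2 * deriv h z + z * deriv (deriv h) z) - 2
      = ((2 : ℝ) : ℂ) * ((1 - z) * deriv h z) + (1 - z) * (z * deriv (deriv h) z) - 2 by
        push_cast; ring, Complex.sub_re, Complex.add_re, Complex.re_ofReal_mul]
    simp
  linarith

theorem re_one_add_div_deriv_pos (ha : AnalyticOnNhd ℂ h unitDisk) (h1 : deriv h 0 = 1)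
    (hsum : Summable fun n : {n : ℕ // 2 ≤ n} => coeffTerm (coeff h) n)
    (hle : ∑' n : {n : ℕ // 2 ≤ n}, coeffTerm (coeff h) n ≤ 2) (hz : z ∈ unitDisk) :
    0 < ((deriv h z + z * deriv (deriv h) z) / deriv h z).re := by
  have h2 := norm_add_norm_le_two_mul ha h1 hsum hle hz
  have hz1 : ‖z‖ < 1 := mem_ball_zero_iff.1 hz
  have hne : deriv h z ≠ 0 := fun h0 => by
    have := re_one_sub_mul_deriv_pos ha h1 hsum hle hz
    simp [h0] at this
  have hne1 : 1 - z ≠ 0 := fun h0 => by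
    rw [← sub_eq_zero.1 h0] at hz1; simp at hz1
  set A := (1 - z) * (2 * deriv h z + z * deriv (deriv h) z) with hA
  set B := (1 - z) * (z * deriv (deriv h) z) with hB
  have h3 : ‖B‖ < ‖A‖ := by
    have := norm_sub_norm_le (2 : ℂ) A
    rw [norm_sub_rev, Complex.norm_ofNat] at this
    linarith
  have h4 : A - B ≠ 0 := fun h0 => by
    rw [sub_eq_zero.1 h0] at h3; exact lt_irrefl _ h3
  -- `A + B = 2(1 - z)(h' + zh'')` and `A - B = 2(1 - z)h'`; the quotient has real part of the sign
  -- of `|A|² - |B|²`.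
  have h5 : (deriv h z + z * deriv (deriv h) z) / deriv h z = (A + B) / (A - B) := by
    rw [div_eq_div_iff hne h4, hA, hB]; ring
  have h6 : ((A + B) / (A - B)).re = (‖A‖ ^ 2 - ‖B‖ ^ 2) / Complex.normSq (A - B) := by
    rw [Complex.div_re, ← add_div, ← Complex.normSq_eq_norm_sq, ← Complex.normSq_eq_norm_sq,
      Complex.normSq_apply A, Complex.normSq_apply B]
    congr 1
    simp only [Complex.add_re, Complex.add_im, Complex.sub_re, Complex.sub_im]
    ring
  rw [h5, h6]
  have h7 : ‖B‖ ^ 2 < ‖A‖ ^ 2 := by gcongr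
  exact div_pos (sub_pos.2 h7) (Complex.normSq_pos.2 h4)

/-- The first half of `coeffTerm` is the increment of `n(n + 1)aₙ`. Summable increments keep this
sequence bounded, so `aₙ = O(1/n²)` and the Taylor series converges absolutely up to the circle. -/
theorem isBounded_image_unitDisk (ha : AnalyticOnNhd ℂ h unitDisk)
    (hsum : Summable fun n : {n : ℕ // 2 ≤ n} => coeffTerm (coeff h) n) :
    Bornology.IsBounded (h '' unitDisk) := by
  have hS := hasSum_coeffTerm_add_two hsum
  set M := ∑' n : {n : ℕ // 2 ≤ n}, coeffTerm (coeff h) n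
  set s : ℕ → ℂ := fun n => (n + 1) * ((n + 2) * coeff h (n + 1)) with hs
  have hnn : ∀ m, 0 ≤ coeffTerm (coeff h) (m + 2) := fun m => by
    rw [coeffTerm_add_two]; positivity
  have hstep : ∀ m, ‖s (m + 1) - s m‖ ≤ coeffTerm (coeff h) (m + 2) := fun m => by
    rw [coeffTerm_add_two]
    refine le_trans (le_of_eq ?_) (le_add_of_nonneg_right (norm_nonneg _))
    congr 1
    simp only [hs]; push_cast; ring
  have hsn : ∀ n, ‖s n‖ ≤ ‖s 0‖ + M := fun n => by
    have h1 : ‖s n‖ ≤ ‖s 0‖ + ∑ m ∈ Finset.range n, coeffTerm (coeff h) (m + 2) := by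
      induction n with
      | zero => simp
      | succ n ih =>
        rw [Finset.sum_range_succ]
        have := norm_sub_norm_le (s (n + 1)) (s n)
        linarith [hstep n]
    have := sum_le_hasSum (Finset.range n) (fun m _ => hnn m) hS
    linarith
  set R := ‖s 0‖ + M with hR
  have hR0 : 0 ≤ R := (norm_nonneg _).trans (hsn 0)
  have hcoef : ∀ n : ℕ, ‖coeff h (n + 1)‖ ≤ R * (((n + 1 : ℕ) : ℝ) ^ 2)⁻¹ := fun n => by
    have h1 := hsn n
    have e1 : ‖(n : ℂ) + 1‖ = (n : ℝ) + 1 := by exact_mod_cast Complex.norm_natCast (n + 1)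
    have e2 : ‖(n : ℂ) + 2‖ = (n : ℝ) + 2 := by exact_mod_cast Complex.norm_natCast (n + 2)
    simp only [hs, norm_mul, e1, e2] at h1
    rw [← div_eq_mul_inv, le_div_iff₀ (by positivity)]
    push_cast
    nlinarith [norm_nonneg (coeff h (n + 1)),
      mul_nonneg (norm_nonneg (coeff h (n + 1))) (Nat.cast_nonneg (α := ℝ) n)]
  have hsumm : Summable fun n : ℕ => ‖coeff h n‖ := by
    rw [← summable_nat_add_iff 1]
    refine Summable.of_nonneg_of_le (fun _ => norm_nonneg _) hcoef (Summable.mul_left _ ?_)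
    exact (summable_nat_add_iff 1).2 (Real.summable_nat_pow_inv.2 one_lt_two)
  refine isBounded_iff_forall_norm_le.2 ⟨∑' n, ‖coeff h n‖, ?_⟩
  rintro _ ⟨z, hz, rfl⟩
  rw [← (hasSum_coeff ha hz).tsum_eq]
  refine tsum_of_norm_bounded hsumm.hasSum fun n => ?_
  rw [norm_mul, norm_pow]
  exact mul_le_of_le_one_right (norm_nonneg _)
    (pow_le_one₀ (norm_nonneg z) (mem_ball_zero_iff.1 hz).le)

end Coefficients

/-! ### Jacobian of a harmonic map and openness of its image -/

section Jacobian

/-- The real derivative of `h + conj g` in terms of the complex derivatives `a` of `h` and `b` of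
`g`. -/
noncomputable def wirtingerMap (a b : ℂ) : ℂ →L[ℝ] ℂ :=
  a • (1 : ℂ →L[ℝ] ℂ) + (Complex.conjCLE : ℂ →L[ℝ] ℂ).comp (b • (1 : ℂ →L[ℝ] ℂ))

theorem wirtingerMap_apply (a b w : ℂ) : wirtingerMap a b w = a * w + conj (b * w) := by
  simp [wirtingerMap]

theorem det_wirtingerMap (a b : ℂ) : (wirtingerMap a b).det = ‖a‖ ^ 2 - ‖b‖ ^ 2 := by
  rw [ContinuousLinearMap.det, ← LinearMap.det_toMatrix Complex.basisOneI, Matrix.det_fin_two,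
    ← Complex.normSq_eq_norm_sq, ← Complex.normSq_eq_norm_sq, Complex.normSq_apply,
    Complex.normSq_apply]
  simp only [LinearMap.toMatrix_apply, ContinuousLinearMap.coe_coe, Complex.coe_basisOneI,
    Complex.coe_basisOneI_repr, wirtingerMap_apply]
  simp
  ring

theorem IsNormalizedHarmonic.hasStrictFDerivAt {f h g : ℂ → ℂ} (hf : IsNormalizedHarmonic f h g)
    {z : ℂ} (hz : z ∈ unitDisk) :
    HasStrictFDerivAt f (wirtingerMap (deriv h z) (deriv g z)) z := by
  have h1 := (hf.analytic_h z hz).hasStrictDerivAt.complexToReal_fderiv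
  have h2 := (hf.analytic_g z hz).hasStrictDerivAt.complexToReal_fderiv
  have h3 := h1.add ((Complex.conjCLE : ℂ →L[ℝ] ℂ).hasStrictFDerivAt.comp z h2)
  refine h3.congr_of_eventuallyEq ?_
  filter_upwards [isOpen_ball.mem_nhds hz] with w hw using (hf.decomp w hw).symm

theorem IsNormalizedHarmonic.norm_deriv_lt {f h g : ℂ → ℂ} (hf : IsNormalizedHarmonic f h g)
    (hsense : SensePreserving f) {z : ℂ} (hz : z ∈ unitDisk) : ‖deriv g z‖ < ‖deriv h z‖ := by
  have h1 := hsense z hz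
  rw [(hf.hasStrictFDerivAt hz).hasFDerivAt.fderiv, det_wirtingerMap] at h1
  exact lt_of_pow_lt_pow_left₀ 2 (norm_nonneg _) (sub_pos.1 h1)

theorem IsNormalizedHarmonic.isOpen_image {f h g : ℂ → ℂ} (hf : IsNormalizedHarmonic f h g)
    (hsense : SensePreserving f) : IsOpen (f '' unitDisk) := by
  rw [isOpen_iff_mem_nhds]
  rintro _ ⟨z, hz, rfl⟩
  have h1 := hf.hasStrictFDerivAt hz
  have h2 : (wirtingerMap (deriv h z) (deriv g z)).det ≠ 0 := by
    have := hsense z hz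
    rw [h1.hasFDerivAt.fderiv] at this
    exact this.ne'
  rw [← h1.map_nhds_eq_of_surj ?_]
  · exact image_mem_map (isOpen_ball.mem_nhds hz)
  · exact LinearMap.range_eq_top.2
      (ContinuousLinearMap.toContinuousLinearEquivOfDetNeZero _ h2).surjective

end Jacobian

/-! ### Harmonic maps as perturbations of the identity -/

/-- A function on a convex set whose derivative has norm less than one is strictly nonexpansive. -/
theorem norm_sub_lt_of_norm_deriv_lt_one {Ω : Set ℂ} (hconv : Convex ℝ Ω) {G G' : ℂ → ℂ}
    (hG : ∀ w ∈ Ω, HasDerivAt G (G' w) w) (hcont : ContinuousOn G' Ω) (hlt : ∀ w ∈ Ω, ‖G' w‖ < 1)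
    {a b : ℂ} (ha : a ∈ Ω) (hb : b ∈ Ω) (hab : a ≠ b) : ‖G a - G b‖ < ‖a - b‖ := by
  have hsub : segment ℝ a b ⊆ Ω := hconv.segment_subset ha hb
  have hcomp : IsCompact (segment ℝ a b) := by
    rw [segment_eq_image_lineMap]
    exact isCompact_Icc.image AffineMap.lineMap_continuous
  -- The maximum of `‖G'‖` on the compact segment is attained, hence a Lipschitz constant strictly
  -- below `1`.
  obtain ⟨m, hm, hmax⟩ := hcomp.exists_isMaxOn ⟨a, left_mem_segment ℝ a b⟩
    (hcont.mono hsub).norm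
  have h1 := Convex.norm_image_sub_le_of_norm_hasDerivWithin_le
    (fun x hx => (hG x (hsub hx)).hasDerivWithinAt) (fun x hx => hmax hx)
    (convex_segment a b) (right_mem_segment ℝ a b) (left_mem_segment ℝ a b)
  exact h1.trans_lt (mul_lt_of_lt_one_left (norm_pos_iff.2 (sub_ne_zero.2 hab)) (hlt m (hsub hm)))

/-- A sense-preserving harmonic function whose analytic part is a bounded convex univalent function
is univalent and close-to-convex. -/
theorem IsNormalizedHarmonic.mem_classCH {f h g : ℂ → ℂ} (hf : IsNormalizedHarmonic f h g)
    (hsense : SensePreserving f) (hinj : InjOn h unitDisk) (hconv : Convex ℝ (h '' unitDisk))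
    (hbdd : Bornology.IsBounded (h '' unitDisk)) : f ∈ classCH := by
  have hU : IsOpen unitDisk := isOpen_ball
  have h0 : (0 : ℂ) ∈ unitDisk := by simp [unitDisk]
  have hd : ∀ z ∈ unitDisk, deriv h z ≠ 0 := fun z hz =>
    norm_pos_iff.1 ((norm_nonneg _).trans_lt (hf.norm_deriv_lt hsense hz))
  set H := Function.invFunOn h unitDisk with hH
  have hHh : ∀ z ∈ unitDisk, H (h z) = z := fun z hz => hinj.leftInvOn_invFunOn hz
  have hHd : ∀ w ∈ h '' unitDisk, HasDerivAt H (deriv h (H w))⁻¹ w := by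
    rintro _ ⟨z, hz, rfl⟩
    rw [hHh z hz]
    exact hasDerivAt_invFunOn hU hf.analytic_h hinj hd hz
  have hHm : MapsTo H (h '' unitDisk) unitDisk := by
    rintro _ ⟨z, hz, rfl⟩
    rwa [hHh z hz]
  have hHc : ContinuousOn H (h '' unitDisk) := fun w hw =>
    (hHd w hw).continuousAt.continuousWithinAt
  have hC : ∀ a ∈ h '' unitDisk, ∀ b ∈ h '' unitDisk, a ≠ b →
      ‖conj (g (H a)) - conj (g (H b))‖ < ‖a - b‖ := fun a ha b hb hab => by
    rw [← map_sub, RCLike.norm_conj]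
    refine norm_sub_lt_of_norm_deriv_lt_one hconv (G := fun w => g (H w))
      (G' := fun w => deriv g (H w) * (deriv h (H w))⁻¹) (fun w hw => ?_) ?_ (fun w hw => ?_) ha hb hab
    · exact (hf.analytic_g _ (hHm hw)).differentiableAt.hasDerivAt.comp w (hHd w hw)
    · exact (hf.analytic_g.deriv.continuousOn.comp hHc hHm).mul
        ((hf.analytic_h.deriv.continuousOn.comp hHc hHm).inv₀ fun w hw => hd _ (hHm hw))
    · rw [norm_mul, norm_inv, ← div_eq_mul_inv, div_lt_one (norm_pos_iff.2 (hd _ (hHm hw)))]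
      exact hf.norm_deriv_lt hsense (hHm hw)
  have hfeq : ∀ z ∈ unitDisk, f z = h z + conj (g (H (h z))) := fun z hz => by
    rw [hf.decomp z hz, hHh z hz]
  have himg : f '' unitDisk = (fun w => w + conj (g (H w))) '' (h '' unitDisk) := by
    rw [image_image]
    exact image_congr hfeq
  refine ⟨⟨⟨h, g, hf⟩, fun x hx y hy hxy => ?_, hsense⟩, ?_⟩
  · by_contra hne
    have h1 := hC _ (mem_image_of_mem h hx) _ (mem_image_of_mem h hy) fun e => hne (hinj hx hy e)
    have h2 := inner_add_pos h1
    rw [← add_sub_add_comm, ← hfeq x hx, ← hfeq y hy, hxy, sub_self, inner_zero_left] at h2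
    exact lt_irrefl _ h2
  · have hopen := hf.isOpen_image hsense
    rw [himg] at hopen ⊢
    exact isCloseToConvexDomain_image_add hconv
      (isOpen_image_of_deriv_ne_zero hU hf.analytic_h hd) ⟨_, mem_image_of_mem h h0⟩ hbdd hC hopen

end HarmonicMapping

theorem mainTheorem3 (f h g : ℂ → ℂ)
    (hf : HarmonicMapping.IsNormalizedHarmonic f h g)
    (hloc : HarmonicMapping.LocallyUnivalent f)
    (hsense : HarmonicMapping.SensePreserving f)
    (hsum : Summable fun n : {n : ℕ // 2 ≤ n} =>
      HarmonicMapping.coeffTerm (HarmonicMapping.coeff h) n)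
    (hle : ∑' n : {n : ℕ // 2 ≤ n},
      HarmonicMapping.coeffTerm (HarmonicMapping.coeff h) n ≤ 2) :
    f ∈ HarmonicMapping.classCH := by
  have ha := hf.analytic_h
  have hinj := HarmonicMapping.injOn_of_re_one_sub_mul_deriv_pos ha fun z hz =>
    HarmonicMapping.re_one_sub_mul_deriv_pos ha hf.deriv_h_zero hsum hle hz
  refine hf.mem_classCH hsense hinj (HarmonicMapping.convex_image_unitDisk ha hinj (fun z hz => ?_)
    fun z hz => HarmonicMapping.re_one_add_div_deriv_pos ha hf.deriv_h_zero hsum hle hz)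
    (HarmonicMapping.isBounded_image_unitDisk ha hsum)
  exact norm_pos_iff.1 ((norm_nonneg _).trans_lt (hf.norm_deriv_lt hsense hz))
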